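/- **Setting.** Let $T\ge 1$ and $n\ge 1$ be integers, $Z$ a measurable space of samples, $\mathcal D_1,\dots,\mathcal D_T$ probability distributions on $Z$, and $z^*\in Z$ a target. A joint dataset is $D=(D_1,\dots,D_T)$ with batches $D_t\in Z^n$. At step $t$ a randomized mechanism $\mathcal M_t$ (a Markov kernel) is applied to the accumulated data $D_1,\dots,D_t$ (and possibly to the outputs $o_1,\dots,o_{t-1}$ already released) and releases an output $o_t$ in a measurable space $O_t$. Let $\mathcal M$ be the composed global mechanism $D\mapsto o=(o_1,\dots,o_T)$. It is $(\varepsilon,\delta)$-DP if $\Pr[\mathcal M(D)\in S]\le e^{\varepsilon}\Pr[\mathcal M(D')\in S]+\delta$ for all measurable $S$ and all joint datasets $D,D'$ that differ in one element. **One round of the SeMI game.** Let $\nu_B$ and $\nu_\tau$ be probability distributions on $\{0,1\}$ and $\{1,\dots,T\}$. Draw independently $B\sim\nu_B$ and $\tau\sim\nu_\tau$. Draw $D$ with independent batches $D_t\sim\mathcal D_t^{\otimes n}$; if $B=1$, replace the $J$-th entry of $D_\tau$ by $z^*$, where $J$ is uniform on $\{1,\dots,n\}$ and independent of everything else. Finally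 draw $o\sim\mathcal M(D)$. **Estimator.** Let $S=S(o,\tau)$ be a real-valued test statistic, measurable in $o$. For each $\gamma\in\mathbb R$, consider the test that predicts membership when $S>\gamma$. Run $R\ge 0$ independent rounds and record the indicators $B_1,\dots,B_R$ and the values $S_1,\dots,S_R$ of the statistic. For $i\in\{0,1\}$ let $N_i=\#\{r: B_r=i\}$, and let $$\widehat\alpha_R(\gamma)=\frac1{N_0}\sum_{r=1}^R \mathbf 1(S_r>\gamma)\mathbf 1(B_r=0),\qquad \widehat\beta_R(\gamma)=\frac1{N_1}\sum_{r=1}^R \mathbf 1(S_r\le\gamma)\mathbf 1(B_r=1).$$ For $\xi>0$ let $$\overline\alpha_R^{\xi}(\gamma)=\widehat\alpha_R(\gamma)+\sqrt{\frac{\log(4/\xi)}{2N_0}},\qquad \overline\beta_R^{\xi}(\gamma)=\widehat\beta_R(\gamma)+\sqrt{\frac{\log(4/\xi)}{2N_1}},$$ where a bound is $+\infty$ if its count $N_i$ is $0$, and let $$\underline\varepsilon_R^{\xi}(\delta)=\log\left(\sup_{\gamma\in\mathbb R}\max\left[\frac{1-\delta-\overline\alpha_R^{\xi}(\gamma)}{\overline\beta_R^{\xi}(\gamma)},\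 \frac{1-\delta-\overline\beta_R^{\xi}(\gamma)}{\overline\alpha_R^{\xi}(\gamma)}\right]\right)\in[-\infty,+\infty],$$ with $\log x=-\infty$ for $x\le 0$, $x/(+\infty)=0$ for every $x\in[-\infty,+\infty)$, and $-\infty/x=-\infty$ for $0<x<\infty$. (For $\xi\ge1$ the claim below holds trivially; for $\xi>4$ the negative radicands are read as $0$, and any quotient by $0$ is read as $0$.) **Lemma.** Let $\varepsilon\ge 0$, $\delta\in[0,1)$ and $\xi>0$. If $\mathcal M$ is $(\varepsilon,\delta)$-DP, then $$\mathbb P\left(\varepsilon\ \ge\ \underline\varepsilon_R^{\xi}(\delta)\right)\ \ge\ 1-\xi .$$ -/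

import Mathlib

open MeasureTheory ProbabilityTheory

noncomputable section

namespace SeMI

/-- A joint dataset over `T` steps: `D t k` is the `k`-th sample of the batch collected at step
`t`, every batch containing `n` samples. -/
abbrev Dataset (T n : ℕ) (Z : Type*) : Type _ := Fin T → Fin n → Z

/-- Sequences of outputs `(o_0, …, o_{T-1})` of `T` successive releases. -/
abbrev Outputs (O : ℕ → Type*) (T : ℕ) : Type _ := (t : Fin T) → O t

section Mechanism

variable {Z : Type*} [MeasurableSpace Z] {O : ℕ → Type*} [∀ t, MeasurableSpace (O t)] {n : ℕ}

/-- Append the output released at step `t` to the earlier outputs. -/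
def appendOutput (O : ℕ → Type*) (t : ℕ) (p : Outputs O t × O t) : Outputs O (t + 1) :=
  Fin.snoc (α := fun i : Fin (t + 1) => O i) p.1 p.2

lemma measurable_appendOutput (O : ℕ → Type*) [∀ t, MeasurableSpace (O t)] (t : ℕ) :
    Measurable (appendOutput O t) := by
  refine measurable_pi_lambda _ fun i => ?_
  refine Fin.lastCases ?_ (fun j => ?_) i
  · simpa [appendOutput] using (measurable_snd : Measurable (Prod.snd : Outputs O t × O t → O t))
  · have h : Measurable fun p : Outputs O t × O t => p.1 j :=
      (measurable_pi_apply j).comp measurable_fst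
    simpa [appendOutput] using h

lemma measurable_dropLast (Z : Type*) [MeasurableSpace Z] (n t : ℕ) :
    Measurable (fun D : Dataset (t + 1) n Z => fun i : Fin t => D i.castSucc) :=
  measurable_pi_lambda _ fun i => measurable_pi_apply i.castSucc

/-- The global mechanism obtained by running the intermediate mechanisms one after the other:
at step `t` the mechanism `M t` is applied to the data accumulated so far (it may also use the
outputs already released) and releases a fresh output. A randomized mechanism is
a Markov kernel from inputs to outputs. -/
def globalMechanism (M : (t : ℕ) → Kernel (Dataset (t + 1) n Z × Outputs O t) (O t)) :
    (T : ℕ) → Kernel (Dataset T n Z) (Outputs O T)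
  | 0 => Kernel.const _ (Measure.dirac fun i : Fin 0 => i.elim0)
  | t + 1 =>
    (((globalMechanism M t).comap (fun D i => D i.castSucc) (measurable_dropLast Z n t)) ⊗ₖ
      M t).map (appendOutput O t)

instance isMarkovKernel_globalMechanism
    (M : (t : ℕ) → Kernel (Dataset (t + 1) n Z × Outputs O t) (O t))
    [∀ t, IsMarkovKernel (M t)] (T : ℕ) : IsMarkovKernel (globalMechanism M T) := by
  induction T with
  | zero => unfold globalMechanism; infer_instance
  | succ t ih =>
    unfold globalMechanism
    exact Kernel.IsMarkovKernel.map _ (measurable_appendOutput O t)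

end Mechanism

/-- Two joint datasets differ in (at most) one element. -/
def Neighbors {T n : ℕ} {Z : Type*} (D D' : Dataset T n Z) : Prop :=
  ∃ (t : Fin T) (j : Fin n), ∀ s k, (s, k) ≠ (t, j) → D s k = D' s k

/-- `(ε, δ)`-differential privacy of a randomized mechanism acting on joint datasets. -/
def IsDP {T n : ℕ} {Z Y : Type*} [MeasurableSpace Z] [MeasurableSpace Y]
    (M : Kernel (Dataset T n Z) Y) (ε δ : ℝ) : Prop :=
  ∀ D D' : Dataset T n Z, Neighbors D D' → ∀ S : Set Y, MeasurableSet S →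
    (M D).real S ≤ Real.exp ε * (M D').real S + δ

section Game

variable {T n : ℕ} {Z : Type*} [MeasurableSpace Z]

/-- Replace the `j`-th entry of the batch of step `τ` by the target `z`. -/
def insertTarget (z : Z) (τ : Fin T) (j : Fin n) (D : Dataset T n Z) : Dataset T n Z :=
  Function.update D τ (Function.update (D τ) j z)

lemma measurable_insertTarget (z : Z) (τ : Fin T) :
    Measurable fun p : Dataset T n Z × Fin n => insertTarget z τ p.2 p.1 := by
  refine measurable_from_prod_countable_left fun j => ?_
  refine measurable_pi_lambda _ fun s => measurable_pi_lambda _ fun k => ?_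
  have h : Measurable fun D : Dataset T n Z => D s k :=
    (measurable_pi_apply k).comp (measurable_pi_apply s)
  by_cases hs : s = τ
  · subst hs
    by_cases hk : k = j
    · subst hk; simp [insertTarget]
    · simpa [insertTarget, hk] using h
  · simpa [insertTarget, hs] using h

/-- Law of the joint dataset without the target (hypothesis OUT): all samples are independent,
and those of step `t` have law `𝒟 t`. -/
def lawOut (𝒟 : Fin T → Measure Z) : Measure (Dataset T n Z) :=
  Measure.pi fun t => Measure.pi fun _ : Fin n => 𝒟 t

/-- Law of the joint dataset when the target `z` is inserted at step `τ` (hypothesis IN): a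
uniformly chosen entry of the batch of step `τ` is replaced by `z`. -/
def lawIn (𝒟 : Fin T → Measure Z) (z : Z) (τ : Fin T) : Measure (Dataset T n Z) :=
  ((lawOut 𝒟).prod (uniformOn (Set.univ : Set (Fin n)))).map fun p => insertTarget z τ p.2 p.1

/-- Law of the joint dataset given the insertion indicator and the insertion time. -/
def dataKernel (n : ℕ) (𝒟 : Fin T → Measure Z) (z : Z) :
    Kernel (Bool × Fin T) (Dataset T n Z) :=
  Kernel.ofFunOfCountable fun p => if p.1 then lawIn 𝒟 z p.2 else lawOut 𝒟

instance isMarkovKernel_dataKernel [NeZero n] (𝒟 : Fin T → Measure Z)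
    [∀ t, IsProbabilityMeasure (𝒟 t)] (z : Z) : IsMarkovKernel (dataKernel n 𝒟 z) := by
  have h0 : IsProbabilityMeasure (lawOut 𝒟 : Measure (Dataset T n Z)) := by
    unfold lawOut; infer_instance
  have hu : IsProbabilityMeasure (uniformOn (Set.univ : Set (Fin n))) :=
    isProbabilityMeasure_uniformOn Set.finite_univ Set.univ_nonempty
  refine ⟨fun p => ?_⟩
  change IsProbabilityMeasure (if p.1 then lawIn 𝒟 z p.2 else lawOut 𝒟)
  split_ifs
  · exact Measure.isProbabilityMeasure_map (measurable_insertTarget z p.2).aemeasurable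
  · exact h0

/-- Law of the transcript `((B, τ), (o_1, …, o_T))` of one round of the game: draw the insertion
indicator `B ∼ νB` and, independently, the insertion time `τ ∼ ντ`, then the dataset, and run the
global mechanism `M` on it. -/
def roundLaw {Y : Type*} [MeasurableSpace Y] (M : Kernel (Dataset T n Z) Y)
    (𝒟 : Fin T → Measure Z) (z : Z) (νB : Measure Bool) (ντ : Measure (Fin T)) :
    Measure ((Bool × Fin T) × Y) :=
  (νB.prod ντ) ⊗ₘ (M ∘ₖ dataKernel n 𝒟 z)

/-- Law of the transcripts of `R` independent rounds of the game. -/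
def gameLaw {Y : Type*} [MeasurableSpace Y] (M : Kernel (Dataset T n Z) Y)
    (𝒟 : Fin T → Measure Z) (z : Z) (νB : Measure Bool) (ντ : Measure (Fin T)) (R : ℕ) :
    Measure (Fin R → (Bool × Fin T) × Y) :=
  Measure.pi fun _ => roundLaw M 𝒟 z νB ντ

end Game

section Estimator

variable {R : ℕ}

/-- Number of rounds whose membership indicator equals `i`. -/
def count (B : Fin R → Bool) (i : Bool) : ℕ := ∑ r, if B r = i then 1 else 0

/-- Empirical Type I error of the test that predicts membership when the statistic exceeds `γ`;
`B` are the membership indicators and `X` the values of the test statistic. -/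
def empTypeI (B : Fin R → Bool) (X : Fin R → ℝ) (γ : ℝ) : ℝ :=
  (1 / (count B false : ℝ)) *
    ∑ r, (if γ < X r then 1 else 0) * (if B r = false then 1 else 0)

/-- Empirical Type II error of the same test. -/
def empTypeII (B : Fin R → Bool) (X : Fin R → ℝ) (γ : ℝ) : ℝ :=
  (1 / (count B true : ℝ)) *
    ∑ r, (if X r ≤ γ then 1 else 0) * (if B r = true then 1 else 0)

/-- Upper confidence bound on the Type I error. It is `+∞` when no round has indicator `0`. -/
def ucbTypeI (ξ : ℝ) (B : Fin R → Bool) (X : Fin R → ℝ) (γ : ℝ) : EReal :=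
  if count B false = 0 then ⊤
  else ((empTypeI B X γ + Real.sqrt (Real.log (4 / ξ) / (2 * (count B false : ℝ))) : ℝ) : EReal)

/-- Upper confidence bound on the Type II error. It is `+∞` when no round has indicator `1`. -/
def ucbTypeII (ξ : ℝ) (B : Fin R → Bool) (X : Fin R → ℝ) (γ : ℝ) : EReal :=
  if count B true = 0 then ⊤
  else ((empTypeII B X γ + Real.sqrt (Real.log (4 / ξ) / (2 * (count B true : ℝ))) : ℝ) : EReal)

/-- The estimated lower bound on `ε`, optimized over all thresholds. The logarithm of
a nonpositive number is `-∞` (then the data give no information on `ε`). -/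
def epsilonLB (ξ δ : ℝ) (B : Fin R → Bool) (X : Fin R → ℝ) : EReal :=
  ENNReal.log (⨆ γ : ℝ, max
    ((1 - (δ : EReal) - ucbTypeI ξ B X γ) / ucbTypeII ξ B X γ)
    ((1 - (δ : EReal) - ucbTypeII ξ B X γ) / ucbTypeI ξ B X γ)).toENNReal

end Estimator

end SeMI

end

/-!
Two facts combine. First, differential privacy constrains the membership tests: inserting the target
couples the two dataset laws so that the coupled datasets are neighbours, hence the laws `σ₀`, `σ₁`
of the statistic under the two hypotheses satisfy `σ b A ≤ exp ε * σ (!b) A + δ`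
(`statLaw_real_le`). Applied to `Iic γ` and `Ioi γ`, this bounds both quotients in the estimator
by `exp ε` as soon as the upper confidence bounds dominate the true error probabilities for all `γ`
(`epsilonLB_le`).

Second, given the membership indicators, the confidence bounds of either type hold for all `γ`
simultaneously up to probability `ξ / 4`. This is the one-sided Dvoretzky–Kiefer–Wolfowitz
inequality with Massart's exponent, without restriction on the level: for a chain of events, the
probability that some empirical frequency among `N` samples falls short of its mean by more than `l`
is at most `exp (-2 N l ^ 2)`.

The proof of the latter is a change of measure. For every `0 < l < 1` there is one factor `a < 1`
such that multiplying the density by `a` on an event of probability `s`, and renormalizing on the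
complement, makes the likelihood ratio at least `exp (2 N l ^ 2)` when the event has frequency at
most `s - l`, whatever `s` is (`exists_uniform_tilt`). Written in terms of the logarithm `u` of the
odds ratio, the exponent is `log a + l * u + ((1 - a) / a) * (u / (exp u - 1))`, convex in `u`;
the factor `a` is chosen so that the minimum over `u` is a Bernoulli divergence, which
Pinsker's inequality bounds below by `2 * l ^ 2`. Since `a` does not depend on `s`, tilting the
largest event of a finite chain restricts to the tilt of every smaller one, so that a single tilted
law can be used on all the events "the shortfall first occurs at `j`"
(`pi_disjointed_shortfall_le`). These are disjoint, and their tilted probabilities sum to at most one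
(`pi_exists_shortfall_le`). Half-lines with rational end points exhaust the general case
(`pi_iUnion_undershoot_le`).
-/

open MeasureTheory ProbabilityTheory

noncomputable section

namespace SeMI

/-! ### A uniform lower bound for Bernoulli likelihood ratios -/

lemma tangent_le_of_hasDerivAt2_nonneg {D : Set ℝ} (hD : Convex ℝ D)
    {f f' f'' : ℝ → ℝ} (hf : ∀ x ∈ D, HasDerivAt f (f' x) x)
    (hf' : ∀ x ∈ D, HasDerivAt f' (f'' x) x) (hf'' : ∀ x ∈ D, 0 ≤ f'' x)
    {x y : ℝ} (hx : x ∈ D) (hy : y ∈ D) : f x + f' x * (y - x) ≤ f y := by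
  have hc : ConvexOn ℝ D f :=
    convexOn_of_hasDerivWithinAt2_nonneg hD
      (fun u hu => (hf u hu).continuousAt.continuousWithinAt)
      (fun u hu => (hf u (interior_subset hu)).hasDerivWithinAt)
      (fun u hu => (hf' u (interior_subset hu)).hasDerivWithinAt)
      (fun u hu => hf'' u (interior_subset hu))
  rcases lt_trichotomy x y with h | h | h
  · have := hc.le_slope_of_hasDerivAt hx hy h (hf x hx)
    rw [slope_def_field, le_div_iff₀ (by linarith)] at this
    linarith
  · subst h; simp
  · have := hc.slope_le_of_hasDerivAt hy hx h (hf x hx)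
    rw [slope_def_field, div_le_iff₀ (by linarith)] at this
    linarith

/-- Pinsker's inequality for two Bernoulli laws: the divergence is at least twice the squared
difference of the parameters. -/
lemma two_mul_sq_le_bernoulli_kl {p q : ℝ} (hp : p ∈ Set.Ioo (0 : ℝ) 1)
    (hq : q ∈ Set.Ioo (0 : ℝ) 1) :
    2 * (q - p) ^ 2 ≤ p * Real.log (p / q) + (1 - p) * Real.log ((1 - p) / (1 - q)) := by
  have key := tangent_le_of_hasDerivAt2_nonneg (D := Set.Ioo (0 : ℝ) 1) (convex_Ioo 0 1)
    (f := fun x => x * Real.log x - x * Real.log q + ((1 - x) * Real.log (1 - x)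
      - (1 - x) * Real.log (1 - q)) - 2 * (x - q) ^ 2)
    (f' := fun x => Real.log x - Real.log q - Real.log (1 - x) + Real.log (1 - q) - 4 * (x - q))
    (f'' := fun x => 1 / x + 1 / (1 - x) - 4) ?_ ?_ ?_ hq hp
  · simp only [sub_self] at key
    rw [Real.log_div hp.1.ne' hq.1.ne', Real.log_div (by linarith [hp.2]) (by linarith [hq.2])]
    nlinarith [key]
  · intro x hx
    have h1 : HasDerivAt (fun x : ℝ => 1 - x) (-1) x := by
      simpa using (hasDerivAt_id x).const_sub 1
    have hx1 : 1 - x ≠ 0 := by linarith [hx.2]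
    have h2 := (Real.hasDerivAt_mul_log hx.1.ne').sub ((hasDerivAt_id x).mul_const (Real.log q))
    have h3 := ((h1.mul (h1.log hx1)).sub (h1.mul_const (Real.log (1 - q))))
    have h4 := (((hasDerivAt_id x).sub_const q).pow 2).const_mul 2
    refine ((h2.add h3).sub h4).congr_deriv ?_
    simp only [id]
    field_simp
    ring
  · intro x hx
    have h1 : HasDerivAt (fun x : ℝ => 1 - x) (-1) x := by
      simpa using (hasDerivAt_id x).const_sub 1
    have hx1 : 1 - x ≠ 0 := by linarith [hx.2]
    have h2 := ((((Real.hasDerivAt_log hx.1.ne').sub_const (Real.log q)).sub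
      (h1.log hx1)).add_const (Real.log (1 - q))).sub
      (((hasDerivAt_id x).sub_const q).const_mul 4)
    refine h2.congr_deriv ?_
    field_simp
    ring
  · intro x hx
    have hx0 := hx.1
    have hx1 : 0 < 1 - x := by linarith [hx.2]
    have : 1 / x + 1 / (1 - x) - 4 = (1 - 2 * x) ^ 2 / (x * (1 - x)) := by field_simp; ring
    rw [this]; positivity

/-- The tangent-line inequality for the convex function `v ↦ v / (exp v - 1)` on `(0, ∞)`. -/
lemma tangent_le_div_exp_sub_one {u v : ℝ} (hu : 0 < u) (hv : 0 < v) :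
    v / (Real.exp v - 1) - v / (Real.exp v - 1) * (1 - (1 - v / (Real.exp v - 1)) / v) * (u - v)
      ≤ u / (Real.exp u - 1) := by
  have hE : ∀ x ∈ Set.Ioi (0 : ℝ), Real.exp x - 1 ≠ 0 := fun x hx => by
    have : 1 < Real.exp x := Real.one_lt_exp_iff.2 hx
    linarith
  have hd : ∀ x : ℝ, HasDerivAt (fun x => Real.exp x - 1) (Real.exp x) x := fun x =>
    (Real.hasDerivAt_exp x).sub_const 1
  have key := tangent_le_of_hasDerivAt2_nonneg (D := Set.Ioi (0 : ℝ)) (convex_Ioi 0)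
    (f := fun x => x / (Real.exp x - 1))
    (f' := fun x => ((Real.exp x - 1) - x * Real.exp x) / (Real.exp x - 1) ^ 2)
    (f'' := fun x => Real.exp x * (x * (Real.exp x + 1) - 2 * (Real.exp x - 1))
      / (Real.exp x - 1) ^ 3) ?_ ?_ ?_ (Set.mem_Ioi.2 hv) (Set.mem_Ioi.2 hu)
  · convert key using 1
    have := hE v hv
    field_simp
    ring
  · intro x hx
    refine ((hasDerivAt_id x).div (hd x) (hE x hx)).congr_deriv ?_
    simp
  · intro x hx
    have h0 := hE x hx
    refine (((hd x).sub ((hasDerivAt_id x).mul (Real.hasDerivAt_exp x))).div ((hd x).pow 2)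
      (pow_ne_zero 2 h0)).congr_deriv ?_
    simp only [id, Pi.pow_apply, Pi.mul_apply, Pi.sub_apply]
    field_simp
    ring
  · intro x hx
    have hx0 : (0 : ℝ) < x := hx
    have h1 : 0 < Real.exp x - 1 := by
      have : 1 < Real.exp x := Real.one_lt_exp_iff.2 hx0
      linarith
    have h2 := Real.le_log_one_add_of_nonneg h1.le
    rw [add_sub_cancel, Real.log_exp, div_le_iff₀ (by linarith)] at h2
    have h3 : 0 ≤ x * (Real.exp x + 1) - 2 * (Real.exp x - 1) := by linarith
    positivity

/-- With `ψ v = v / (exp v - 1)`, every level `0 < l < 1` is of the form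
`(1 - ψ v) * (1 - (1 - ψ v) / v)`. This is the equation that makes the tilt `a = ψ v` optimal for
the level `l`: it says that `l * u + ((1 - a) / a) * ψ u` is stationary at `u = v`. -/
lemma exists_level_eq {l : ℝ} (h0 : 0 < l) (h1 : l < 1) :
    ∃ v : ℝ, 0 < v ∧ (1 - v / (Real.exp v - 1)) * (1 - (1 - v / (Real.exp v - 1)) / v) = l := by
  have hE : ∀ x : ℝ, 0 < x → x < Real.exp x - 1 := fun x hx => by
    linarith [Real.add_one_lt_exp hx.ne']
  have hψ1 : ∀ x : ℝ, 0 < x → x / (Real.exp x - 1) < 1 := fun x hx => by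
    rw [div_lt_one (by linarith [hE x hx])]; exact hE x hx
  have hψ0 : ∀ x : ℝ, 0 < x → 0 < x / (Real.exp x - 1) := fun x hx =>
    div_pos hx (by linarith [hE x hx])
  set Λ : ℝ → ℝ := fun v => (1 - v / (Real.exp v - 1)) * (1 - (1 - v / (Real.exp v - 1)) / v)
  set t : ℝ := 3 / (1 - l) with ht
  have htl : 3 ≤ t := by rw [ht, le_div_iff₀ (by linarith)]; linarith
  have hcont : ContinuousOn Λ (Set.Icc l t) := by
    have hne : ∀ x ∈ Set.Icc l t, x ≠ 0 := fun x hx => by linarith [hx.1]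
    have hne' : ∀ x ∈ Set.Icc l t, Real.exp x - 1 ≠ 0 := fun x hx => by
      have := hE x (by linarith [hx.1])
      linarith [hx.1]
    have hψ : ContinuousOn (fun v : ℝ => v / (Real.exp v - 1)) (Set.Icc l t) :=
      continuousOn_id.div (by fun_prop) hne'
    exact (continuousOn_const.sub hψ).mul
      (continuousOn_const.sub ((continuousOn_const.sub hψ).div continuousOn_id hne))
  have hlow : Λ l ≤ l := by
    have h2 : 1 - l ≤ l / (Real.exp l - 1) := by
      rw [le_div_iff₀ (by linarith [hE l h0])]
      have h3 := Real.add_one_le_exp (-l)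
      have h4 : Real.exp (-l) * Real.exp l = 1 := by rw [← Real.exp_add]; simp
      nlinarith [Real.exp_pos l]
    have h5 := hψ1 l h0
    have h6 : 0 ≤ (1 - l / (Real.exp l - 1)) / l := div_nonneg (by linarith) h0.le
    have h7 : (1 - l / (Real.exp l - 1)) * (1 - (1 - l / (Real.exp l - 1)) / l)
        ≤ (1 - l / (Real.exp l - 1)) * 1 := mul_le_mul_of_nonneg_left (by linarith) (by linarith)
    change (1 - l / (Real.exp l - 1)) * (1 - (1 - l / (Real.exp l - 1)) / l) ≤ l
    linarith
  have hhigh : l ≤ Λ t := by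
    have ht0 : 0 < t := by linarith
    have hq := Real.quadratic_le_exp_of_nonneg ht0.le
    have h2 : t / (Real.exp t - 1) ≤ 2 / t := by
      rw [div_le_div_iff₀ (by linarith [hE t ht0]) ht0]
      nlinarith
    have h3 : (1 - t / (Real.exp t - 1)) / t ≤ 1 / t := by
      have := hψ0 t ht0
      gcongr; linarith
    have h4 : 1 / t ≤ 1 / 3 := one_div_le_one_div_of_le (by norm_num) htl
    have h5 : 2 / t = 2 * (1 / t) := by ring
    have h6 : 1 - l = 3 * (1 / t) := by rw [ht]; field_simp
    have h7 : (1 - 2 * (1 / t)) * (1 - 1 / t)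
        ≤ (1 - t / (Real.exp t - 1)) * (1 - (1 - t / (Real.exp t - 1)) / t) :=
      mul_le_mul (by linarith) (by linarith) (by linarith) (by linarith)
    change l ≤ (1 - t / (Real.exp t - 1)) * (1 - (1 - t / (Real.exp t - 1)) / t)
    nlinarith [sq_nonneg (1 / t)]
  obtain ⟨v, hv, hvl⟩ := intermediate_value_Icc (by linarith : l ≤ t) hcont ⟨hlow, hhigh⟩
  exact ⟨v, by linarith [hv.1], hvl⟩

/-- Tilting a family of nested events of probability `s` by one and the same factor `a < 1` gives
a likelihood ratio that is uniformly large, on the exponential scale `2 * l ^ 2`, whenever the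
empirical frequency falls short of `s` by `l`. The pair (`a`, minimizing `s`) is a saddle point of
the right-hand side, whose value is a Bernoulli divergence; this is why Pinsker's inequality
applies for all `s` simultaneously. -/
lemma exists_uniform_tilt {l : ℝ} (h0 : 0 < l) (h1 : l < 1) :
    ∃ a : ℝ, 0 < a ∧ a < 1 ∧ ∀ s : ℝ, l ≤ s → s < 1 →
      2 * l ^ 2 ≤ (s - l) * Real.log a
        + (1 - s + l) * Real.log ((1 - a * s) / (1 - s)) := by
  obtain ⟨v, hv, hvl⟩ := exists_level_eq h0 h1
  have hEv : v < Real.exp v - 1 := by linarith [Real.add_one_lt_exp hv.ne']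
  set a : ℝ := v / (Real.exp v - 1) with ha
  have ha0 : 0 < a := div_pos hv (by linarith)
  have ha1 : a < 1 := by rw [ha, div_lt_one (by linarith)]; exact hEv
  have hexpv : Real.exp v - 1 = v / a := by rw [ha]; field_simp
  set s₀ : ℝ := 1 - (1 - a) / v with hs₀
  have hs01 : s₀ < 1 := by
    have : 0 < (1 - a) / v := div_pos (by linarith) hv
    linarith
  have hs00 : 0 < s₀ := by
    by_contra h
    have : (1 - a) * s₀ ≤ 0 := mul_nonpos_of_nonneg_of_nonpos (by linarith) (by linarith)
    linarith
  refine ⟨a, ha0, ha1, fun s hs hs1 => ?_⟩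
  have hs0 : 0 < s := by linarith
  have has : a * s < s := by nlinarith
  set u : ℝ := Real.log ((1 - a * s) / ((1 - s) * a)) with hu
  have hw : 0 < (1 - a * s) / ((1 - s) * a) :=
    div_pos (by linarith) (mul_pos (by linarith) ha0)
  have hexpu : Real.exp u - 1 = (1 - a) / ((1 - s) * a) := by
    rw [hu, Real.exp_log hw]
    have : 1 - s ≠ 0 := by linarith
    field_simp; ring
  have hu0 : 0 < u := by
    have : 0 < (1 - a) / ((1 - s) * a) :=
      div_pos (by linarith) (mul_pos (by linarith) ha0)
    exact Real.one_lt_exp_iff.1 (by linarith)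
  have hlog : Real.log ((1 - a * s) / (1 - s)) = u + Real.log a := by
    rw [hu, ← Real.log_mul hw.ne' ha0.ne']
    congr 1
    have : 1 - s ≠ 0 := by linarith
    field_simp
  have htan := tangent_le_div_exp_sub_one hu0 hv
  rw [← ha, hexpu, ← hs₀] at htan
  have hpin := two_mul_sq_le_bernoulli_kl (p := a * s₀) (q := s₀)
    ⟨mul_pos ha0 hs00, by nlinarith⟩ ⟨hs00, hs01⟩
  have hlog₀ : Real.log ((1 - a * s₀) / (1 - s₀)) = v + Real.log a := by
    have : (1 - a * s₀) / (1 - s₀) = Real.exp v * a := by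
      have h2 : Real.exp v = 1 + v / a := by linarith
      have h3 : 1 - s₀ = (1 - a) / v := by rw [hs₀]; ring
      have h4 : (1 - a) ≠ 0 := by linarith
      rw [h2, h3, hs₀]
      field_simp
      ring
    rw [this, Real.log_mul (Real.exp_pos v).ne' ha0.ne', Real.log_exp]
  have hdiv : a * s₀ / s₀ = a := by field_simp
  rw [hdiv, hlog₀] at hpin
  rw [hlog]
  -- in the variable `u` the right-hand side is `log a + l * u + ((1 - a) / a) * (u / (exp u - 1))`
  have hκ : (1 - a) / a * (u / ((1 - a) / ((1 - s) * a))) = (1 - s) * u := by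
    have h4 : (1 - a) ≠ 0 := by linarith
    field_simp
  have htan' := mul_le_mul_of_nonneg_left htan (div_nonneg (by linarith : 0 ≤ 1 - a) ha0.le)
  rw [hκ] at htan'
  have hL : (1 - a) / a * (a - a * s₀ * (u - v)) = (1 - a) - l * (u - v) := by
    rw [← hvl]; field_simp
  rw [hL] at htan'
  have h1s : (1 - s₀) * v = 1 - a := by rw [hs₀]; field_simp; ring
  have hl : s₀ - a * s₀ = l := by rw [← hvl]; ring
  rw [hl] at hpin
  have e1 : a * s₀ * Real.log a + (1 - a * s₀) * (v + Real.log a)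
      = Real.log a + l * v + (1 - a) := by
    rw [← h1s, ← hl]; ring
  linarith

/-- Exponentiated form of `exists_uniform_tilt` for `k` successes and `m` failures. The
strict inequality excludes `m = 0`, which matters when `s = 1`. -/
lemma exists_tilt_pow_le {l : ℝ} (h0 : 0 < l) (h1 : l < 1) :
    ∃ a : ℝ, 0 < a ∧ a < 1 ∧ ∀ s : ℝ, 0 ≤ s → s ≤ 1 → ∀ k m : ℕ,
      (k : ℝ) + (k + m : ℕ) * l < (k + m : ℕ) * s →
      (1 - s) ^ m ≤ Real.exp (-(2 * (k + m : ℕ) * l ^ 2)) * (a ^ k * (1 - a * s) ^ m) := by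
  obtain ⟨a, ha0, ha1, ha⟩ := exists_uniform_tilt h0 h1
  refine ⟨a, ha0, ha1, fun s hs0 hs1 k m hk => ?_⟩
  push_cast at hk ⊢
  have hk0 : (0 : ℝ) ≤ k := k.cast_nonneg
  have hm0 : (0 : ℝ) ≤ m := m.cast_nonneg
  have hN : (0 : ℝ) < k + m := by
    by_contra h
    have h2 : (k : ℝ) + m = 0 := by linarith
    rw [h2] at hk; linarith
  have has : 0 < 1 - a * s := by nlinarith
  rcases hs1.lt_or_eq with hs1 | rfl
  · have hls : l ≤ s := by
      by_contra h
      have : (k + m : ℝ) * s ≤ (k + m) * l := mul_le_mul_of_nonneg_left (by linarith) hN.le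
      linarith
    have h := ha s hls hs1
    have hY : 1 ≤ (1 - a * s) / (1 - s) := by
      rw [le_div_iff₀ (by linarith)]; nlinarith
    have hY0 : 0 < (1 - a * s) / (1 - s) := by linarith
    have hlogY : 0 ≤ Real.log ((1 - a * s) / (1 - s)) := Real.log_nonneg hY
    have hloga : Real.log a ≤ 0 := Real.log_nonpos ha0.le ha1.le
    set A := Real.log a
    set Y := Real.log ((1 - a * s) / (1 - s)) with hYdef
    have hfin : 2 * (k + m) * l ^ 2 ≤ k * A + m * Y := by
      have e1 : (k + m) * ((s - l) * A + (1 - s + l) * Y)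
          = k * A + m * Y + ((k + m) * s - (k + (k + m) * l)) * (A - Y) := by ring
      have e2 : ((k + m) * s - (k + (k + m) * l)) * (A - Y) ≤ 0 :=
        mul_nonpos_of_nonneg_of_nonpos (by linarith) (by linarith)
      have e3 := mul_le_mul_of_nonneg_left h hN.le
      linarith
    have hexp : 1 ≤ Real.exp (-(2 * (k + m) * l ^ 2))
        * (a ^ k * ((1 - a * s) / (1 - s)) ^ m) := by
      have e1 : a ^ k = Real.exp (k * A) := by
        rw [Real.exp_nat_mul, Real.exp_log ha0]
      have e2 : ((1 - a * s) / (1 - s)) ^ m = Real.exp (m * Y) := by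
        rw [Real.exp_nat_mul, Real.exp_log hY0]
      rw [e1, e2, ← Real.exp_add, ← Real.exp_add]
      exact Real.one_le_exp (by linarith)
    have h1s : 0 < (1 - s) ^ m := pow_pos (by linarith) m
    calc (1 - s) ^ m = 1 * (1 - s) ^ m := (one_mul _).symm
      _ ≤ _ := mul_le_mul_of_nonneg_right hexp h1s.le
      _ = _ := by rw [div_pow]; field_simp
  · have hm : m ≠ 0 := by
      rintro rfl
      have : (0 : ℝ) ≤ k * l := by positivity
      simp at hk
      linarith
    simp only [sub_self, zero_pow hm]
    positivity

lemma measure_le_mul_of_singleton_le {α : Type*} [Countable α] [MeasurableSpace α]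
    [MeasurableSingletonClass α] {μ ν : Measure α} {c : ENNReal} {E : Set α}
    (h : ∀ x ∈ E, μ {x} ≤ c * ν {x}) : μ E ≤ c * ν E := by
  rw [← Measure.tsum_indicator_apply_singleton μ E E.to_countable.measurableSet,
    ← Measure.tsum_indicator_apply_singleton ν E E.to_countable.measurableSet,
    ← ENNReal.tsum_mul_left]
  refine ENNReal.tsum_le_tsum fun x => ?_
  by_cases hx : x ∈ E
  · simpa [hx] using h x hx
  · simp [hx]

/-! ### A maximal inequality for nested events -/

/-- The probability law `σ` on `ℕ` tilted by the factor `a` on `{0, …, m}`; the missing mass is put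
at `m + 1`. -/
def tiltedLaw (σ : Measure ℕ) (a : ℝ) (m : ℕ) : Measure ℕ :=
  ENNReal.ofReal a • σ.restrict (Set.Iic m)
    + ENNReal.ofReal (1 - a * σ.real (Set.Iic m)) • Measure.dirac (m + 1)

lemma tiltedLaw_apply_of_subset {σ : Measure ℕ} (a : ℝ) {m : ℕ} {A : Set ℕ} (hA : A ⊆ Set.Iic m) :
    tiltedLaw σ a m A = ENNReal.ofReal a * σ A := by
  have h : m + 1 ∉ A := fun h => by simpa using hA h
  simp [tiltedLaw, Measure.restrict_apply, Set.inter_eq_left.2 hA, h]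

section tiltedLaw

variable {σ : Measure ℕ} [IsProbabilityMeasure σ] {a : ℝ} {m j : ℕ}

lemma isProbabilityMeasure_tiltedLaw (ha0 : 0 ≤ a) (ha1 : a ≤ 1) :
    IsProbabilityMeasure (tiltedLaw σ a m) := by
  refine ⟨?_⟩
  have h1 : a * σ.real (Set.Iic m) ≤ 1 := mul_le_one₀ ha1 measureReal_nonneg measureReal_le_one
  simp only [tiltedLaw, Measure.coe_add, Measure.coe_smul, Pi.add_apply, Pi.smul_apply,
    Measure.restrict_apply_univ, smul_eq_mul, measure_univ, mul_one]
  rw [← ofReal_measureReal, ← ENNReal.ofReal_mul ha0,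
    ← ENNReal.ofReal_add (by positivity) (by linarith)]
  simp

lemma tiltedLaw_Ioi (ha0 : 0 ≤ a) (ha1 : a ≤ 1) (hj : j ≤ m) :
    tiltedLaw σ a m (Set.Ioi j) = ENNReal.ofReal (1 - a * σ.real (Set.Iic j)) := by
  have := isProbabilityMeasure_tiltedLaw (σ := σ) (m := m) ha0 ha1
  rw [← Set.compl_Iic, prob_compl_eq_one_sub (by measurability),
    tiltedLaw_apply_of_subset a (Set.Iic_subset_Iic.2 hj), ← ofReal_measureReal,
    ← ENNReal.ofReal_mul ha0, ENNReal.ofReal_sub _ (by positivity), ENNReal.ofReal_one]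

end tiltedLaw

lemma map_min_singleton_of_le (σ : Measure ℕ) {j k : ℕ} (h : k ≤ j) :
    σ.map (fun x => min x (j + 1)) {k} = σ {k} := by
  rw [Measure.map_apply (measurable_of_countable _) (measurableSet_singleton _)]
  congr 1
  ext x
  simp only [Set.mem_preimage, Set.mem_singleton_iff]
  omega

lemma map_min_singleton_succ (σ : Measure ℕ) (j : ℕ) :
    σ.map (fun x => min x (j + 1)) {j + 1} = σ (Set.Ioi j) := by
  rw [Measure.map_apply (measurable_of_countable _) (measurableSet_singleton _)]
  congr 1
  ext x
  simp only [Set.mem_preimage, Set.mem_singleton_iff, Set.mem_Ioi]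
  omega

lemma map_min_singleton_of_gt (σ : Measure ℕ) {j k : ℕ} (h : j + 1 < k) :
    σ.map (fun x => min x (j + 1)) {k} = 0 := by
  rw [Measure.map_apply (measurable_of_countable _) (measurableSet_singleton _)]
  have : (fun x => min x (j + 1)) ⁻¹' {k} = ∅ := by
    refine Set.eq_empty_of_forall_notMem fun x hx => ?_
    simp only [Set.mem_preimage, Set.mem_singleton_iff] at hx
    omega
  rw [this, measure_empty]

/-- The samples in `I` whose number of values `≤ j` falls short of its mean by more than the
fraction `l` of the sample size. -/
def shortfall {ι : Type*} (I : Finset ι) (σ : Measure ℕ) (l : ℝ) (j : ℕ) : Set (ι → ℕ) :=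
  {k | (({i ∈ I | k i ≤ j} : Finset ι).card : ℝ) + I.card * l < I.card * σ.real (Set.Iic j)}

lemma min_mem_shortfall_iff {ι : Type*} {I : Finset ι} {σ : Measure ℕ} {l : ℝ} {j p : ℕ}
    (hp : p ≤ j) (k : ι → ℕ) :
    (fun i => min (k i) (j + 1)) ∈ shortfall I σ l p ↔ k ∈ shortfall I σ l p := by
  have : ∀ i, min (k i) (j + 1) ≤ p ↔ k i ≤ p := fun i => by omega
  simp only [shortfall, Set.mem_ofPred_eq, this]

/-- Comparison of the original and the tilted product law on the event that the shortfall first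
occurs at `j`. This event only depends on the samples truncated at `j + 1`, and there the
likelihood ratio is controlled by the choice of the tilt. -/
lemma pi_disjointed_shortfall_le {ι : Type*} [Fintype ι] [DecidableEq ι] {I : Finset ι}
    {μ : ι → Measure ℕ} [∀ i, IsProbabilityMeasure (μ i)] {σ : Measure ℕ} [IsProbabilityMeasure σ]
    (hμ : ∀ i ∈ I, μ i = σ) {l a : ℝ} (ha0 : 0 < a) (ha1 : a < 1)
    (ha : ∀ s : ℝ, 0 ≤ s → s ≤ 1 → ∀ k m : ℕ,
      (k : ℝ) + (k + m : ℕ) * l < (k + m : ℕ) * s →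
      (1 - s) ^ m ≤ Real.exp (-(2 * (k + m : ℕ) * l ^ 2)) * (a ^ k * (1 - a * s) ^ m))
    {j m : ℕ} (hj : j ≤ m) :
    Measure.pi μ (disjointed (shortfall I σ l) j) ≤
      ENNReal.ofReal (Real.exp (-(2 * I.card * l ^ 2))) *
        Measure.pi (fun i => if i ∈ I then tiltedLaw σ a m else μ i)
          (disjointed (shortfall I σ l) j) := by
  set ν : ι → Measure ℕ := fun i => if i ∈ I then tiltedLaw σ a m else μ i with hν
  have hνp : ∀ i, IsProbabilityMeasure (ν i) := fun i => by
    by_cases h : i ∈ I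
    · simpa [hν, h] using isProbabilityMeasure_tiltedLaw ha0.le ha1.le
    · simp only [hν, h, if_false]; infer_instance
  set E := disjointed (shortfall I σ l) j with hE
  set t : ℕ → ℕ := fun x => min x (j + 1) with ht
  have htm : Measurable t := measurable_of_countable _
  have htm' : Measurable fun (k : ι → ℕ) i => t (k i) := measurable_of_countable _
  have hinv : (fun (k : ι → ℕ) i => t (k i)) ⁻¹' E = E := by
    ext k
    simp only [hE, disjointed_eq_inter_compl, Set.mem_preimage, Set.mem_inter_iff, Set.mem_iInter,
      Set.mem_compl_iff]
    refine and_congr (min_mem_shortfall_iff le_rfl k) (forall₂_congr fun p hp => ?_)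
    exact not_congr (min_mem_shortfall_iff hp.le k)
  have hmap : ∀ (η : ι → Measure ℕ) [∀ i, IsProbabilityMeasure (η i)],
      Measure.pi η E = Measure.pi (fun i => (η i).map t) E := by
    intro η _
    have hp : ∀ i, IsProbabilityMeasure ((η i).map t) := fun i =>
      Measure.isProbabilityMeasure_map htm.aemeasurable
    rw [← Measure.pi_map_pi (fun i => htm.aemeasurable),
      Measure.map_apply htm' E.to_countable.measurableSet, hinv]
  rw [hmap μ, hmap ν]
  have hp : ∀ i, IsProbabilityMeasure ((μ i).map t) := fun i =>
    Measure.isProbabilityMeasure_map htm.aemeasurable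
  have hp' : ∀ i, IsProbabilityMeasure ((ν i).map t) := fun i =>
    Measure.isProbabilityMeasure_map htm.aemeasurable
  refine measure_le_mul_of_singleton_le fun k hk => ?_
  have hkj : k ∈ shortfall I σ l j := disjointed_subset _ _ hk
  rw [Measure.pi_singleton, Measure.pi_singleton, ← Finset.prod_mul_prod_compl I,
    ← Finset.prod_mul_prod_compl I (fun i => (ν i).map t {k i}), ← mul_assoc]
  have hcompl : ∏ i ∈ Iᶜ, (ν i).map t {k i} = ∏ i ∈ Iᶜ, (μ i).map t {k i} :=
    Finset.prod_congr rfl fun i hi => by simp [hν, Finset.mem_compl.1 hi]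
  rw [hcompl]
  gcongr ?_ * _
  set s : ℝ := σ.real (Set.Iic j) with hs
  set e : ℕ → ENNReal := fun x => if x ≤ j then σ {x} else if x = j + 1 then 1 else 0 with he
  have hσ : ∀ i ∈ I, (μ i).map t {k i}
      = (if k i ≤ j then 1 else ENNReal.ofReal (1 - s)) * e (k i) := by
    intro i hi
    rw [hμ i hi]
    rcases lt_trichotomy (k i) (j + 1) with h | h | h
    · have h' : k i ≤ j := by omega
      simp only [he, h', if_true, one_mul]
      exact map_min_singleton_of_le σ h'
    · have h' : ¬ k i ≤ j := by omega
      simp only [he, h, if_true]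
      rw [map_min_singleton_succ, ← Set.compl_Iic, prob_compl_eq_one_sub (by measurability), hs,
        ENNReal.ofReal_sub _ measureReal_nonneg, ofReal_measureReal]
      simp
    · have h' : ¬ k i ≤ j := by omega
      simp only [he, h', h.ne', if_false, mul_zero]
      exact map_min_singleton_of_gt σ h
  have hτ : ∀ i ∈ I, (ν i).map t {k i}
      = (if k i ≤ j then ENNReal.ofReal a else ENNReal.ofReal (1 - a * s)) * e (k i) := by
    intro i hi
    simp only [hν, hi, if_true]
    rcases lt_trichotomy (k i) (j + 1) with h | h | h
    · have h' : k i ≤ j := by omega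
      simp only [he, h', if_true]
      rw [map_min_singleton_of_le _ h', tiltedLaw_apply_of_subset]
      simpa using h'.trans hj
    · have h' : ¬ k i ≤ j := by omega
      simp only [he, h, if_true]
      rw [map_min_singleton_succ, tiltedLaw_Ioi ha0.le ha1.le hj]
      simp [hs]
    · have h' : ¬ k i ≤ j := by omega
      simp only [he, h', h.ne', if_false, mul_zero]
      exact map_min_singleton_of_gt _ h
  rw [Finset.prod_congr rfl hσ, Finset.prod_congr rfl hτ, Finset.prod_mul_distrib,
    Finset.prod_mul_distrib, ← mul_assoc]
  gcongr ?_ * _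
  rw [Finset.prod_ite, Finset.prod_ite]
  simp only [Finset.prod_const, one_pow, one_mul]
  have hcard := Finset.card_filter_add_card_filter_not (s := I) (fun i => k i ≤ j)
  simp only [shortfall, Set.mem_ofPred_eq] at hkj
  rw [← hcard] at hkj ⊢
  have hs1 : s ≤ 1 := measureReal_le_one
  have := ha s measureReal_nonneg hs1 _ _ hkj
  have has : 0 ≤ 1 - a * s := by nlinarith
  rw [← ENNReal.ofReal_pow (by linarith), ← ENNReal.ofReal_pow ha0.le, ← ENNReal.ofReal_pow has,
    ← ENNReal.ofReal_mul (by positivity), ← ENNReal.ofReal_mul (by positivity)]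
  exact ENNReal.ofReal_le_ofReal this

/-- One-sided maximal inequality with the sharp constant, for samples in `ℕ`. -/
lemma pi_exists_shortfall_le {ι : Type*} [Fintype ι] {I : Finset ι}
    {μ : ι → Measure ℕ} [∀ i, IsProbabilityMeasure (μ i)] {σ : Measure ℕ} [IsProbabilityMeasure σ]
    (hμ : ∀ i ∈ I, μ i = σ) {l : ℝ} (hl : 0 < l) (m : ℕ) :
    Measure.pi μ (⋃ j ∈ Finset.range (m + 1), shortfall I σ l j) ≤
      ENNReal.ofReal (Real.exp (-(2 * I.card * l ^ 2))) := by
  classical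
  rcases lt_or_ge l 1 with hl1 | hl1
  · obtain ⟨a, ha0, ha1, ha⟩ := exists_tilt_pow_le hl hl1
    set ν : ι → Measure ℕ := fun i => if i ∈ I then tiltedLaw σ a m else μ i with hν
    have hνp : ∀ i, IsProbabilityMeasure (ν i) := fun i => by
      by_cases h : i ∈ I
      · simpa [hν, h] using isProbabilityMeasure_tiltedLaw ha0.le ha1.le
      · simp only [hν, h, if_false]; infer_instance
    have hcover : (⋃ j ∈ Finset.range (m + 1), shortfall I σ l j)
        ⊆ ⋃ j ∈ Finset.range (m + 1), disjointed (shortfall I σ l) j := by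
      intro k hk
      simp only [Set.mem_iUnion, Finset.mem_range, exists_prop] at hk ⊢
      have hex : ∃ j, k ∈ shortfall I σ l j := ⟨_, hk.choose_spec.2⟩
      refine ⟨Nat.find hex, (Nat.find_min' hex hk.choose_spec.2).trans_lt hk.choose_spec.1, ?_⟩
      rw [disjointed_eq_inter_compl]
      refine ⟨Nat.find_spec hex, ?_⟩
      simp only [Set.mem_iInter, Set.mem_compl_iff]
      exact fun p hp => Nat.find_min hex hp
    calc Measure.pi μ (⋃ j ∈ Finset.range (m + 1), shortfall I σ l j)
        ≤ ∑ j ∈ Finset.range (m + 1), Measure.pi μ (disjointed (shortfall I σ l) j) :=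
          (measure_mono hcover).trans (measure_biUnion_finset_le _ _)
      _ ≤ ∑ j ∈ Finset.range (m + 1), ENNReal.ofReal (Real.exp (-(2 * I.card * l ^ 2))) *
            Measure.pi ν (disjointed (shortfall I σ l) j) := by
          refine Finset.sum_le_sum fun j hj => ?_
          exact pi_disjointed_shortfall_le hμ ha0 ha1 ha
            (Nat.lt_succ_iff.1 (Finset.mem_range.1 hj))
      _ = ENNReal.ofReal (Real.exp (-(2 * I.card * l ^ 2))) *
            Measure.pi ν (⋃ j ∈ Finset.range (m + 1), disjointed (shortfall I σ l) j) := by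
          rw [← Finset.mul_sum, measure_biUnion_finset]
          · exact fun i _ j _ hij => disjoint_disjointed _ hij
          · exact fun j _ => Set.Countable.measurableSet (Set.to_countable _)
      _ ≤ ENNReal.ofReal (Real.exp (-(2 * I.card * l ^ 2))) * 1 := by
          gcongr; exact prob_le_one
      _ = _ := mul_one _
  · -- a shortfall of the whole sample size is impossible
    have : (⋃ j ∈ Finset.range (m + 1), shortfall I σ l j) = ∅ := by
      simp only [Set.iUnion_eq_empty]
      intro j _
      ext k
      simp only [shortfall, Set.mem_ofPred_eq, Set.mem_empty_iff_false, iff_false, not_lt]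
      have h1 : σ.real (Set.Iic j) ≤ l := measureReal_le_one.trans hl1
      have h2 : (I.card : ℝ) * σ.real (Set.Iic j) ≤ I.card * l :=
        mul_le_mul_of_nonneg_left h1 (Nat.cast_nonneg _)
      have h3 : (0 : ℝ) ≤ (({i ∈ I | k i ≤ j} : Finset ι).card : ℝ) := Nat.cast_nonneg _
      linarith
    rw [this, measure_empty]
    exact zero_le

/-! ### The one-sided Dvoretzky–Kiefer–Wolfowitz–Massart inequality -/

/-- The event, for samples indexed by `I`, that the empirical frequency of `A` falls short of its
`σ`-probability by more than `l`; both sides are multiplied by the sample size. -/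
def undershoot {ι X : Type*} [MeasurableSpace X] (I : Finset ι) (σ : Measure X) (l : ℝ)
    (A : Set X) : Set (ι → X) :=
  open scoped Classical in
  {x | (({i ∈ I | x i ∈ A} : Finset ι).card : ℝ) + I.card * l < I.card * σ.real A}

section

variable {ι : Type*} [Fintype ι] {I : Finset ι} {l : ℝ}

/-- The maximal inequality for finitely many events of a chain. The chain is described by a rank
function `K`: the event with index `γ` is the sublevel set `{x | K x ≤ r γ}`. -/
lemma pi_biUnion_undershoot_le {X Γ : Type*} [MeasurableSpace X] {μ : ι → Measure X}
    [∀ i, IsProbabilityMeasure (μ i)] {σ : Measure X} [IsProbabilityMeasure σ]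
    (hμ : ∀ i ∈ I, μ i = σ) (hl : 0 < l) (G : Finset Γ) (A : Γ → Set X) {K : X → ℕ}
    (hK : Measurable K) (r : Γ → ℕ) (h : ∀ γ ∈ G, ∀ x, x ∈ A γ ↔ K x ≤ r γ) :
    Measure.pi μ (⋃ γ ∈ G, undershoot I σ l (A γ)) ≤
      ENNReal.ofReal (Real.exp (-(2 * I.card * l ^ 2))) := by
  classical
  have hp : ∀ i, IsProbabilityMeasure ((μ i).map K) := fun i =>
    Measure.isProbabilityMeasure_map hK.aemeasurable
  have hp' : IsProbabilityMeasure (σ.map K) := Measure.isProbabilityMeasure_map hK.aemeasurable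
  have hKm : Measurable fun (x : ι → X) i => K (x i) :=
    measurable_pi_lambda _ fun i => hK.comp (measurable_pi_apply i)
  set m := G.sup r
  have hsub : (⋃ γ ∈ G, undershoot I σ l (A γ)) ⊆ (fun (x : ι → X) i => K (x i)) ⁻¹'
      ⋃ j ∈ Finset.range (m + 1), shortfall I (σ.map K) l j := by
    intro x hx
    simp only [Set.mem_iUnion, exists_prop, Set.mem_preimage] at hx ⊢
    obtain ⟨γ, hγ, hx⟩ := hx
    refine ⟨r γ, Finset.mem_range.2 (Nat.lt_succ_iff.2 (Finset.le_sup hγ)), ?_⟩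
    have hA : A γ = K ⁻¹' Set.Iic (r γ) := by ext y; simpa using h γ hγ y
    simp only [undershoot, Set.mem_ofPred_eq, h γ hγ] at hx
    simp only [shortfall, Set.mem_ofPred_eq]
    rw [map_measureReal_apply hK measurableSet_Iic, ← hA]
    convert hx
  calc _ ≤ _ := measure_mono hsub
    _ ≤ ((Measure.pi μ).map fun x i => K (x i)) _ := Measure.le_map_apply hKm.aemeasurable _
    _ = Measure.pi (fun i => (μ i).map K) _ := by
      rw [Measure.pi_map_pi (fun i => hK.aemeasurable)]
    _ ≤ _ := pi_exists_shortfall_le (fun i hi => by rw [hμ i hi]) hl m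

/-- The maximal inequality for a chain of events indexed by `ℝ` that is continuous from the right:
rational indices suffice, and finitely many of them by monotone convergence. -/
lemma pi_iUnion_undershoot_le {X : Type*} [MeasurableSpace X] {μ : ι → Measure X}
    [∀ i, IsProbabilityMeasure (μ i)] {σ : Measure X} [IsProbabilityMeasure σ]
    (hμ : ∀ i ∈ I, μ i = σ) (hl : 0 < l) (A : ℝ → Set X) (hAm : ∀ γ, MeasurableSet (A γ))
    (hchain : ∀ G : Finset ℝ, ∃ (K : X → ℕ) (r : ℝ → ℕ), Measurable K ∧
      ∀ γ ∈ G, ∀ x, x ∈ A γ ↔ K x ≤ r γ)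
    (hright : ∀ γ x, ∀ᶠ γ' in nhdsWithin γ (Set.Ioi γ), (x ∈ A γ' ↔ x ∈ A γ)) :
    Measure.pi μ (⋃ γ, undershoot I σ l (A γ)) ≤
      ENNReal.ofReal (Real.exp (-(2 * I.card * l ^ 2))) := by
  classical
  have hrat : (⋃ γ, undershoot I σ l (A γ)) ⊆
      ⋃ G : Finset ℚ, ⋃ q ∈ G, undershoot I σ l (A (q : ℝ)) := by
    intro x hx
    obtain ⟨γ, hγ⟩ := Set.mem_iUnion.1 hx
    have h1 : ∀ᶠ γ' in nhdsWithin γ (Set.Ioi γ), ∀ i, (x i ∈ A γ' ↔ x i ∈ A γ) :=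
      Filter.eventually_all.2 fun i => hright γ (x i)
    have h2 : Filter.Tendsto (fun γ' => σ.real (A γ')) (nhdsWithin γ (Set.Ioi γ))
        (nhds (σ.real (A γ))) := by
      refine (ENNReal.tendsto_toReal (measure_ne_top _ _)).comp ?_
      exact tendsto_measure_of_tendsto_indicator_of_isFiniteMeasure _ σ hAm (hright γ)
    simp only [undershoot, Set.mem_ofPred_eq] at hγ
    have h3 := (h2.const_mul (I.card : ℝ)).eventually (lt_mem_nhds hγ)
    obtain ⟨u, hu, hsub⟩ := mem_nhdsGT_iff_exists_Ioo_subset.1 (h1.and h3)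
    obtain ⟨q, hq1, hq2⟩ := exists_rat_btwn (Set.mem_Ioi.1 hu)
    obtain ⟨hq3, hq4⟩ := hsub ⟨hq1, hq2⟩
    simp only [Set.mem_iUnion]
    refine ⟨{q}, q, Finset.mem_singleton_self q, ?_⟩
    simp only [undershoot, Set.mem_ofPred_eq, hq3]
    exact hq4
  refine (measure_mono hrat).trans ?_
  rw [Directed.measure_iUnion]
  · refine iSup_le fun G => ?_
    obtain ⟨K, r, hK, h⟩ := hchain (G.image (fun q : ℚ => (q : ℝ)))
    exact pi_biUnion_undershoot_le hμ hl G (fun q : ℚ => A (q : ℝ)) hK (fun q : ℚ => r (q : ℝ))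
      fun q hq x => h q (Finset.mem_image_of_mem _ hq) x
  · refine directed_of_isDirected_le fun G G' hG => ?_
    exact Set.biUnion_subset_biUnion_left hG

variable {μ : ι → Measure ℝ} [∀ i, IsProbabilityMeasure (μ i)] {σ : Measure ℝ}
  [IsProbabilityMeasure σ]

lemma pi_iUnion_undershoot_Ioi_le (hμ : ∀ i ∈ I, μ i = σ) (hl : 0 < l) :
    Measure.pi μ (⋃ γ : ℝ, undershoot I σ l (Set.Ioi γ)) ≤
      ENNReal.ofReal (Real.exp (-(2 * I.card * l ^ 2))) := by
  classical
  refine pi_iUnion_undershoot_le hμ hl _ (fun γ => measurableSet_Ioi) (fun G => ?_) fun γ x => ?_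
  · refine ⟨fun x => ({g ∈ G | x ≤ g} : Finset ℝ).card, fun y => ({g ∈ G | y < g} : Finset ℝ).card,
      ?_, fun γ hγ x => ⟨fun hx => ?_, fun hx => ?_⟩⟩
    · refine Antitone.measurable fun x y hxy => Finset.card_le_card ?_
      exact Finset.monotone_filter_right _ fun g _ hg => hxy.trans hg
    · exact Finset.card_le_card
        (Finset.monotone_filter_right _ fun g _ hg => lt_of_lt_of_le hx hg)
    · by_contra h
      refine absurd hx (not_le.2 (Finset.card_lt_card ?_))
      refine Finset.ssubset_iff.2 ⟨γ, by simp, ?_⟩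
      intro g hg
      have hxγ : x ≤ γ := not_lt.1 h
      rcases Finset.mem_insert.1 hg with rfl | hg
      · exact Finset.mem_filter.2 ⟨hγ, hxγ⟩
      · obtain ⟨hg1, hg2⟩ := Finset.mem_filter.1 hg
        exact Finset.mem_filter.2 ⟨hg1, hxγ.trans hg2.le⟩
  · rcases lt_or_ge γ x with h | h
    · filter_upwards [Ioo_mem_nhdsGT h] with y hy
      simp [h, hy.2]
    · filter_upwards [self_mem_nhdsWithin] with y hy
      simp [h.not_gt, (h.trans (le_of_lt hy)).not_gt]

lemma pi_iUnion_undershoot_Iic_le (hμ : ∀ i ∈ I, μ i = σ) (hl : 0 < l) :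
    Measure.pi μ (⋃ γ : ℝ, undershoot I σ l (Set.Iic γ)) ≤
      ENNReal.ofReal (Real.exp (-(2 * I.card * l ^ 2))) := by
  classical
  refine pi_iUnion_undershoot_le hμ hl _ (fun γ => measurableSet_Iic) (fun G => ?_) fun γ x => ?_
  · refine ⟨fun x => ({g ∈ G | g < x} : Finset ℝ).card, fun y => ({g ∈ G | g < y} : Finset ℝ).card,
      ?_, fun γ hγ x => ⟨fun hx => ?_, fun hx => ?_⟩⟩
    · refine Monotone.measurable fun x y hxy => Finset.card_le_card ?_
      exact Finset.monotone_filter_right _ fun g _ hg => lt_of_lt_of_le hg hxy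
    · exact Finset.card_le_card
        (Finset.monotone_filter_right _ fun g _ hg => lt_of_lt_of_le hg hx)
    · by_contra h
      refine absurd hx (not_le.2 (Finset.card_lt_card ?_))
      refine Finset.ssubset_iff.2 ⟨γ, by simp, ?_⟩
      intro g hg
      have hγx : γ < x := not_le.1 h
      rcases Finset.mem_insert.1 hg with rfl | hg
      · exact Finset.mem_filter.2 ⟨hγ, hγx⟩
      · obtain ⟨hg1, hg2⟩ := Finset.mem_filter.1 hg
        exact Finset.mem_filter.2 ⟨hg1, hg2.trans hγx⟩
  · rcases lt_or_ge γ x with h | h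
    · filter_upwards [Ioo_mem_nhdsGT h] with y hy
      simp [h.not_ge, hy.2.not_ge]
    · filter_upwards [self_mem_nhdsWithin] with y hy
      simp [h, h.trans (le_of_lt hy)]

end

/-! ### Law of the test statistic given the membership indicator -/

section Game

variable {T n : ℕ} {Z : Type*} [MeasurableSpace Z] {Y : Type*} [MeasurableSpace Y]

/-- Law of the test statistic `S o τ` in a round whose membership indicator is `b`. -/
def statLaw (M : Kernel (Dataset T n Z) Y) (𝒟 : Fin T → Measure Z) (z : Z)
    (ντ : Measure (Fin T)) (S : Y → Fin T → ℝ) (b : Bool) : Measure ℝ :=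
  (ντ ⊗ₘ ((M ∘ₖ dataKernel n 𝒟 z).comap (fun τ => (b, τ)) measurable_prodMk_left)).map
    fun p => S p.2 p.1

variable {M : Kernel (Dataset T n Z) Y} {𝒟 : Fin T → Measure Z} {z : Z}
  {ντ : Measure (Fin T)} {S : Y → Fin T → ℝ}

lemma measurable_stat (hS : ∀ τ, Measurable fun o => S o τ) :
    Measurable fun p : Fin T × Y => S p.2 p.1 :=
  measurable_from_prod_countable_right fun τ => hS τ

lemma isProbabilityMeasure_statLaw [NeZero n] [IsMarkovKernel M]
    [∀ t, IsProbabilityMeasure (𝒟 t)] [IsProbabilityMeasure ντ]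
    (hS : ∀ τ, Measurable fun o => S o τ) (b : Bool) :
    IsProbabilityMeasure (statLaw M 𝒟 z ντ S b) :=
  Measure.isProbabilityMeasure_map (measurable_stat hS).aemeasurable

lemma statLaw_apply [NeZero n] [IsMarkovKernel M] [∀ t, IsProbabilityMeasure (𝒟 t)]
    [IsProbabilityMeasure ντ] (hS : ∀ τ, Measurable fun o => S o τ) (b : Bool) {A : Set ℝ}
    (hA : MeasurableSet A) :
    statLaw M 𝒟 z ντ S b A
      = ∫⁻ τ, (M ∘ₖ dataKernel n 𝒟 z) (b, τ) {o | S o τ ∈ A} ∂ντ := by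
  rw [statLaw, Measure.map_apply (measurable_stat hS) hA,
    Measure.compProd_apply (measurable_stat hS hA)]
  rfl

lemma map_restrict_roundLaw [NeZero n] [IsMarkovKernel M] [∀ t, IsProbabilityMeasure (𝒟 t)]
    {νB : Measure Bool} [IsProbabilityMeasure νB]
    [IsProbabilityMeasure ντ] (hS : ∀ τ, Measurable fun o => S o τ) (b : Bool) :
    ((roundLaw M 𝒟 z νB ντ).restrict {w | w.1.1 = b}).map (fun w => S w.2 w.1.2)
      = νB {b} • statLaw M 𝒟 z ντ S b := by
  have hb : MeasurableSet {w : (Bool × Fin T) × Y | w.1.1 = b} :=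
    (measurable_fst.comp measurable_fst) (measurableSet_singleton b)
  have hSm : Measurable fun w : (Bool × Fin T) × Y => S w.2 w.1.2 :=
    (measurable_stat hS).comp ((measurable_snd.comp measurable_fst).prodMk measurable_snd)
  ext A hA
  rw [Measure.map_apply hSm hA, Measure.restrict_apply (hSm hA), roundLaw,
    Measure.compProd_apply ((hSm hA).inter hb),
    lintegral_prod _ (Measurable.aemeasurable (measurable_of_countable _)), lintegral_fintype,
    Finset.sum_eq_single b]
  · rw [Measure.smul_apply, statLaw_apply hS b hA, smul_eq_mul, mul_comm]
    congr 2
    ext τ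
    congr 1
    ext o
    simp
  · intro b' _ hb'
    simp [hb']
  · simp

/-- If, for every sequence of membership indicators, an event on the values of the test statistic
has conditional probability at most `c`, then its probability is at most `c`. -/
lemma gameLaw_le_of_forall_pi_statLaw_le [NeZero n] [IsMarkovKernel M]
    [∀ t, IsProbabilityMeasure (𝒟 t)] {νB : Measure Bool} [IsProbabilityMeasure νB]
    [IsProbabilityMeasure ντ] (hS : ∀ τ, Measurable fun o => S o τ) {R : ℕ}
    {E : (Fin R → Bool) → Set (Fin R → ℝ)} {c : ENNReal}
    (hE : ∀ b, Measure.pi (fun r => statLaw M 𝒟 z ντ S (b r)) (E b) ≤ c) :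
    gameLaw M 𝒟 z νB ντ R
      {w | (fun r => S (w r).2 (w r).1.2) ∈ E fun r => (w r).1.1} ≤ c := by
  have hprob := fun b => isProbabilityMeasure_statLaw (M := M) (𝒟 := 𝒟) (z := z) (ντ := ντ) hS b
  have hSm : Measurable fun w : (Bool × Fin T) × Y => S w.2 w.1.2 :=
    (measurable_stat hS).comp ((measurable_snd.comp measurable_fst).prodMk measurable_snd)
  have hround : IsProbabilityMeasure (roundLaw M 𝒟 z νB ντ) := by
    unfold roundLaw; infer_instance
  set X : (Fin R → (Bool × Fin T) × Y) → Fin R → ℝ := fun w r => S (w r).2 (w r).1.2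
  have hX : Measurable X := measurable_pi_lambda _ fun r => hSm.comp (measurable_pi_apply r)
  set C : (Fin R → Bool) → Set (Fin R → (Bool × Fin T) × Y) := fun b =>
    Set.univ.pi fun r => {w | w.1.1 = b r}
  have hC : ∀ b, MeasurableSet (C b) := fun b => MeasurableSet.univ_pi fun r =>
    (measurable_fst.comp measurable_fst) (measurableSet_singleton (b r))
  have hpi : ∀ b, ((gameLaw M 𝒟 z νB ντ R).restrict (C b)).map X
      = (∏ r, νB {b r}) • Measure.pi fun r => statLaw M 𝒟 z ντ S (b r) := by
    intro b
    have h1 : ∀ r, SigmaFinite (((roundLaw M 𝒟 z νB ντ).restrict {w | w.1.1 = b r}).map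
        fun w => S w.2 w.1.2) := fun r => by infer_instance
    rw [gameLaw, Measure.restrict_pi_pi, Measure.pi_map_pi (fun r => hSm.aemeasurable)]
    refine Measure.pi_eq fun s hs => ?_
    simp only [map_restrict_roundLaw hS, Measure.smul_apply, smul_eq_mul, Measure.pi_pi,
      Finset.prod_mul_distrib]
  have hsum : ∑ b : Fin R → Bool, ∏ r, νB {b r} = 1 := by
    simp_rw [← Measure.pi_singleton (fun _ : Fin R => νB)]
    rw [sum_measure_singleton]
    simp
  have hcover : {w | X w ∈ E fun r => (w r).1.1}
      ⊆ ⋃ b, C b ∩ X ⁻¹' (E b) := fun w hw =>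
    Set.mem_iUnion.2 ⟨fun r => (w r).1.1, fun r _ => rfl, hw⟩
  calc gameLaw M 𝒟 z νB ντ R {w | X w ∈ E fun r => (w r).1.1}
      ≤ ∑ b, gameLaw M 𝒟 z νB ντ R (C b ∩ X ⁻¹' (E b)) :=
        (measure_mono hcover).trans (measure_iUnion_fintype_le _ _)
    _ ≤ ∑ b : Fin R → Bool, (∏ r, νB {b r}) * c := by
        refine Finset.sum_le_sum fun b _ => ?_
        rw [Set.inter_comm, ← Measure.restrict_apply' (hC b)]
        refine (Measure.le_map_apply hX.aemeasurable _).trans ?_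
        rw [hpi b, Measure.smul_apply, smul_eq_mul]
        exact mul_le_mul_right (hE b) _
    _ = c := by rw [← Finset.sum_mul, hsum, one_mul]

end Game

/-! ### Differential privacy bounds the power of the membership tests -/

lemma neighbors_insertTarget {T n : ℕ} {Z : Type*} (z : Z) (τ : Fin T) (j : Fin n)
    (D : Dataset T n Z) : Neighbors D (insertTarget z τ j D) := by
  refine ⟨τ, j, fun s k hsk => ?_⟩
  by_cases hs : s = τ
  · subst hs
    have hk : k ≠ j := fun h => hsk (by rw [h])
    simp [insertTarget, hk]
  · simp [insertTarget, hs]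

lemma Neighbors.symm {T n : ℕ} {Z : Type*} {D D' : Dataset T n Z}
    (h : Neighbors D D') : Neighbors D' D := by
  obtain ⟨t, j, h⟩ := h
  exact ⟨t, j, fun s k hsk => (h s k hsk).symm⟩

section Game

variable {T n : ℕ} {Z : Type*} [MeasurableSpace Z] {Y : Type*} [MeasurableSpace Y]
  {M : Kernel (Dataset T n Z) Y} {𝒟 : Fin T → Measure Z} {z : Z}
  {ντ : Measure (Fin T)} {S : Y → Fin T → ℝ}

/-- An inequality between the values of a function at neighbouring datasets passes to its means
under the two hypotheses of the game, which are coupled by inserting the target. -/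
lemma lintegral_dataKernel_le [NeZero n] [∀ t, IsProbabilityMeasure (𝒟 t)]
    {f : Dataset T n Z → ENNReal} (hf : Measurable f) {c d : ENNReal}
    (h : ∀ D D', Neighbors D D' → f D ≤ c * f D' + d) (τ : Fin T) (b : Bool) :
    ∫⁻ D, f D ∂(dataKernel n 𝒟 z (b, τ)) ≤ c * ∫⁻ D, f D ∂(dataKernel n 𝒟 z (!b, τ)) + d := by
  have h0 : IsProbabilityMeasure (lawOut 𝒟 : Measure (Dataset T n Z)) := by
    unfold lawOut; infer_instance
  have hu : IsProbabilityMeasure (uniformOn (Set.univ : Set (Fin n))) :=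
    isProbabilityMeasure_uniformOn Set.finite_univ Set.univ_nonempty
  have hins := measurable_insertTarget (n := n) z τ
  set P := (lawOut 𝒟 : Measure (Dataset T n Z)).prod (uniformOn (Set.univ : Set (Fin n))) with hP
  have hout : ∫⁻ D, f D ∂(dataKernel n 𝒟 z (false, τ)) = ∫⁻ p, f p.1 ∂P := by
    rw [hP, measurePreserving_fst.lintegral_comp hf]
    rfl
  have hin : ∫⁻ D, f D ∂(dataKernel n 𝒟 z (true, τ))
      = ∫⁻ p, f (insertTarget z τ p.2 p.1) ∂P := by
    rw [hP, ← lintegral_map hf hins]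
    rfl
  have hmean : ∀ {g g' : Dataset T n Z × Fin n → ENNReal}, Measurable g' →
      (∀ p, g p ≤ c * g' p + d) → ∫⁻ p, g p ∂P ≤ c * ∫⁻ p, g' p ∂P + d := by
    intro g g' hg' hle
    refine (lintegral_mono hle).trans ?_
    rw [lintegral_add_right _ measurable_const, lintegral_const_mul _ hg']
    simp
  cases b
  · rw [Bool.not_false, hout, hin]
    exact hmean (hf.comp hins) fun p => h _ _ (neighbors_insertTarget z τ p.2 p.1)
  · rw [Bool.not_true, hout, hin]
    exact hmean (hf.comp measurable_fst) fun p => h _ _ (neighbors_insertTarget z τ p.2 p.1).symm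

lemma statLaw_real_le [NeZero n] [IsMarkovKernel M]
    [∀ t, IsProbabilityMeasure (𝒟 t)] [IsProbabilityMeasure ντ]
    (hS : ∀ τ, Measurable fun o => S o τ) {ε δ : ℝ} (hδ : 0 ≤ δ) (hDP : IsDP M ε δ) (b : Bool)
    {A : Set ℝ} (hA : MeasurableSet A) :
    (statLaw M 𝒟 z ντ S b).real A
      ≤ Real.exp ε * (statLaw M 𝒟 z ντ S (!b)).real A + δ := by
  have hprob := fun b => isProbabilityMeasure_statLaw (M := M) (𝒟 := 𝒟) (z := z) (ντ := ντ) hS b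
  have key : statLaw M 𝒟 z ντ S b A
      ≤ ENNReal.ofReal (Real.exp ε) * statLaw M 𝒟 z ντ S (!b) A + ENNReal.ofReal δ := by
    rw [statLaw_apply hS b hA, statLaw_apply hS (!b) hA,
      ← lintegral_const_mul _ (measurable_of_countable _)]
    have : ENNReal.ofReal δ = ∫⁻ _ : Fin T, ENNReal.ofReal δ ∂ντ := by simp
    rw [this, ← lintegral_add_right _ measurable_const]
    refine lintegral_mono fun τ => ?_
    have hAτ : MeasurableSet {o | S o τ ∈ A} := hS τ hA
    dsimp only
    rw [Kernel.comp_apply' _ _ _ hAτ, Kernel.comp_apply' _ _ _ hAτ]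
    refine lintegral_dataKernel_le (M.measurable_coe hAτ) (fun D D' hD => ?_) τ b
    rw [← ofReal_measureReal, ← ofReal_measureReal, ← ENNReal.ofReal_mul (Real.exp_nonneg ε),
      ← ENNReal.ofReal_add (by positivity) hδ]
    exact ENNReal.ofReal_le_ofReal (hDP D D' hD _ hAτ)
  rw [← ofReal_measureReal, ← ofReal_measureReal, ← ENNReal.ofReal_mul (Real.exp_nonneg ε),
    ← ENNReal.ofReal_add (by positivity) hδ] at key
  exact (ENNReal.ofReal_le_ofReal_iff (by positivity)).1 key

end Game

/-! ### The estimator on the event that the confidence bounds hold -/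

section Estimator

variable {R : ℕ} {ξ : ℝ}

lemma empTypeI_nonneg (B : Fin R → Bool) (X : Fin R → ℝ) (γ : ℝ) : 0 ≤ empTypeI B X γ :=
  mul_nonneg (by positivity) (Finset.sum_nonneg fun r _ => by split_ifs <;> simp)

lemma empTypeII_nonneg (B : Fin R → Bool) (X : Fin R → ℝ) (γ : ℝ) : 0 ≤ empTypeII B X γ :=
  mul_nonneg (by positivity) (Finset.sum_nonneg fun r _ => by split_ifs <;> simp)

lemma radius_pos (hξ0 : 0 < ξ) (hξ1 : ξ < 1) {N : ℕ} (hN : N ≠ 0) :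
    0 < Real.sqrt (Real.log (4 / ξ) / (2 * (N : ℝ))) := by
  have h1 : 0 < Real.log (4 / ξ) := Real.log_pos (by rw [lt_div_iff₀ hξ0]; linarith)
  have : (0 : ℝ) < N := by exact_mod_cast Nat.pos_of_ne_zero hN
  positivity

lemma ucbTypeI_pos (hξ0 : 0 < ξ) (hξ1 : ξ < 1) (B : Fin R → Bool) (X : Fin R → ℝ) (γ : ℝ) :
    0 < ucbTypeI ξ B X γ := by
  unfold ucbTypeI
  split_ifs with h
  · exact EReal.coe_lt_top 0
  · exact_mod_cast add_pos_of_nonneg_of_pos (empTypeI_nonneg B X γ) (radius_pos hξ0 hξ1 h)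

lemma ucbTypeII_pos (hξ0 : 0 < ξ) (hξ1 : ξ < 1) (B : Fin R → Bool) (X : Fin R → ℝ) (γ : ℝ) :
    0 < ucbTypeII ξ B X γ := by
  unfold ucbTypeII
  split_ifs with h
  · exact EReal.coe_lt_top 0
  · exact_mod_cast add_pos_of_nonneg_of_pos (empTypeII_nonneg B X γ) (radius_pos hξ0 hξ1 h)

lemma ereal_sub_div_le {δ α β c : ℝ} (hc : 0 ≤ c) (h : 1 - δ - α ≤ c * β) {a b : EReal}
    (ha : (α : EReal) ≤ a) (hb : (β : EReal) ≤ b) (hb0 : 0 < b) :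
    (1 - (δ : EReal) - a) / b ≤ (c : EReal) := by
  rcases eq_or_ne b ⊤ with rfl | hbt
  · -- division by `⊤` gives `0`
    rw [EReal.div_top]; exact_mod_cast hc
  · rw [EReal.div_le_iff_le_mul hb0 hbt]
    calc 1 - (δ : EReal) - a ≤ 1 - (δ : EReal) - α := EReal.sub_le_sub le_rfl ha
      _ = ((1 - δ - α : ℝ) : EReal) := by push_cast; rfl
      _ ≤ ((c * β : ℝ) : EReal) := by exact_mod_cast h
      _ = (β : EReal) * c := by rw [mul_comm]; push_cast; rfl
      _ ≤ b * c := mul_le_mul_of_nonneg_right hb (by exact_mod_cast hc)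

lemma epsilonLB_le (hξ0 : 0 < ξ) (hξ1 : ξ < 1) {ε δ : ℝ} {B : Fin R → Bool} {X : Fin R → ℝ}
    {α β : ℝ → ℝ} (h1 : ∀ γ, 1 - δ - α γ ≤ Real.exp ε * β γ)
    (h2 : ∀ γ, 1 - δ - β γ ≤ Real.exp ε * α γ)
    (hα : ∀ γ, (α γ : EReal) ≤ ucbTypeI ξ B X γ) (hβ : ∀ γ, (β γ : EReal) ≤ ucbTypeII ξ B X γ) :
    epsilonLB ξ δ B X ≤ (ε : EReal) := by
  have hε : (ε : EReal) = ENNReal.log (((Real.exp ε : ℝ) : EReal)).toENNReal := by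
    rw [EReal.toENNReal_of_ne_top (EReal.coe_ne_top _), EReal.toReal_coe,
      ENNReal.log_ofReal_of_pos (Real.exp_pos ε), Real.log_exp]
  rw [hε, epsilonLB]
  refine ENNReal.log_monotone (EReal.toENNReal_le_toENNReal (iSup_le fun γ => max_le ?_ ?_))
  · exact ereal_sub_div_le (Real.exp_nonneg ε) (h1 γ) (hα γ) (hβ γ) (ucbTypeII_pos hξ0 hξ1 B X γ)
  · exact ereal_sub_div_le (Real.exp_nonneg ε) (h2 γ) (hβ γ) (hα γ) (ucbTypeI_pos hξ0 hξ1 B X γ)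

lemma exp_neg_radius (hξ0 : 0 < ξ) (hξ1 : ξ < 1) {N : ℕ} (hN : N ≠ 0) :
    Real.exp (-(2 * N * Real.sqrt (Real.log (4 / ξ) / (2 * (N : ℝ))) ^ 2)) = ξ / 4 := by
  have h1 : 0 < Real.log (4 / ξ) := Real.log_pos (by rw [lt_div_iff₀ hξ0]; linarith)
  have hN' : (N : ℝ) ≠ 0 := by exact_mod_cast hN
  rw [Real.sq_sqrt (by positivity), show 2 * (N : ℝ) * (Real.log (4 / ξ) / (2 * N))
    = Real.log (4 / ξ) by field_simp, ← Real.log_inv, Real.exp_log (by positivity), inv_div]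

lemma card_filter_eq_count (B : Fin R → Bool) (i : Bool) :
    ({r | B r = i} : Finset (Fin R)).card = count B i := by
  rw [count, Finset.card_filter]

/-- Given the membership indicators, the upper confidence bounds on the Type I error fail to hold
simultaneously with probability at most `ξ / 4`. -/
lemma pi_ucbTypeI_lt_le (hξ0 : 0 < ξ) (hξ1 : ξ < 1) (σ : Bool → Measure ℝ)
    [∀ b, IsProbabilityMeasure (σ b)] (B : Fin R → Bool) :
    Measure.pi (fun r => σ (B r))
      {X | ∃ γ, ucbTypeI ξ B X γ < ((σ false).real (Set.Ioi γ) : EReal)}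
      ≤ ENNReal.ofReal (ξ / 4) := by
  by_cases hN : count B false = 0
  · have : {X : Fin R → ℝ | ∃ γ, ucbTypeI ξ B X γ < ((σ false).real (Set.Ioi γ) : EReal)} = ∅ := by
      ext X; simp [ucbTypeI, hN]
    rw [this, measure_empty]; exact zero_le
  · set l := Real.sqrt (Real.log (4 / ξ) / (2 * (count B false : ℝ))) with hl
    have hN0 : (0 : ℝ) < count B false := by exact_mod_cast Nat.pos_of_ne_zero hN
    set I : Finset (Fin R) := {r | B r = false} with hI
    have hcard : I.card = count B false := card_filter_eq_count B false
    have hdkw := pi_iUnion_undershoot_Ioi_le (I := I) (μ := fun r => σ (B r)) (σ := σ false)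
      (fun r hr => by rw [(Finset.mem_filter.1 hr).2]) (radius_pos hξ0 hξ1 hN)
    rw [hcard, exp_neg_radius hξ0 hξ1 hN] at hdkw
    refine (measure_mono ?_).trans hdkw
    rintro X ⟨γ, hγ⟩
    refine Set.mem_iUnion.2 ⟨γ, ?_⟩
    simp only [ucbTypeI, hN, if_false, EReal.coe_lt_coe_iff] at hγ
    simp only [undershoot, Set.mem_ofPred_eq, hcard, Set.mem_Ioi]
    have hemp : empTypeI B X γ * count B false
        = (({r ∈ I | γ < X r} : Finset (Fin R)).card : ℝ) := by
      rw [empTypeI, Finset.card_filter, hI, Finset.sum_filter]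
      push_cast
      field_simp
      refine Finset.sum_congr rfl fun r _ => ?_
      split_ifs <;> simp
    have := mul_lt_mul_of_pos_right hγ hN0
    rw [add_mul, hemp, mul_comm _ (count B false : ℝ),
      mul_comm ((σ false).real _) (count B false : ℝ)] at this
    convert this

/-- Given the membership indicators, the upper confidence bounds on the Type II error fail to hold
simultaneously with probability at most `ξ / 4`. -/
lemma pi_ucbTypeII_lt_le (hξ0 : 0 < ξ) (hξ1 : ξ < 1) (σ : Bool → Measure ℝ)
    [∀ b, IsProbabilityMeasure (σ b)] (B : Fin R → Bool) :
    Measure.pi (fun r => σ (B r))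
      {X | ∃ γ, ucbTypeII ξ B X γ < ((σ true).real (Set.Iic γ) : EReal)}
      ≤ ENNReal.ofReal (ξ / 4) := by
  by_cases hN : count B true = 0
  · have : {X : Fin R → ℝ | ∃ γ, ucbTypeII ξ B X γ < ((σ true).real (Set.Iic γ) : EReal)} = ∅ := by
      ext X; simp [ucbTypeII, hN]
    rw [this, measure_empty]; exact zero_le
  · set l := Real.sqrt (Real.log (4 / ξ) / (2 * (count B true : ℝ))) with hl
    have hN0 : (0 : ℝ) < count B true := by exact_mod_cast Nat.pos_of_ne_zero hN
    set I : Finset (Fin R) := {r | B r = true} with hI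
    have hcard : I.card = count B true := card_filter_eq_count B true
    have hdkw := pi_iUnion_undershoot_Iic_le (I := I) (μ := fun r => σ (B r)) (σ := σ true)
      (fun r hr => by rw [(Finset.mem_filter.1 hr).2]) (radius_pos hξ0 hξ1 hN)
    rw [hcard, exp_neg_radius hξ0 hξ1 hN] at hdkw
    refine (measure_mono ?_).trans hdkw
    rintro X ⟨γ, hγ⟩
    refine Set.mem_iUnion.2 ⟨γ, ?_⟩
    simp only [ucbTypeII, hN, if_false, EReal.coe_lt_coe_iff] at hγ
    simp only [undershoot, Set.mem_ofPred_eq, hcard, Set.mem_Iic]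
    have hemp : empTypeII B X γ * count B true
        = (({r ∈ I | X r ≤ γ} : Finset (Fin R)).card : ℝ) := by
      rw [empTypeII, Finset.card_filter, hI, Finset.sum_filter]
      push_cast
      field_simp
      refine Finset.sum_congr rfl fun r _ => ?_
      split_ifs <;> simp
    have := mul_lt_mul_of_pos_right hγ hN0
    rw [add_mul, hemp, mul_comm _ (count B true : ℝ),
      mul_comm ((σ true).real _) (count B true : ℝ)] at this
    convert this

end Estimator

end SeMI

end

theorem mainTheorem10
    {T n : ℕ} [NeZero n]
    {Z : Type*} [MeasurableSpace Z]
    {O : ℕ → Type*} [∀ t, MeasurableSpace (O t)]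
    (M : (t : ℕ) → Kernel (SeMI.Dataset (t + 1) n Z × SeMI.Outputs O t) (O t))
    [∀ t, IsMarkovKernel (M t)]
    (𝒟 : Fin T → Measure Z) [∀ t, IsProbabilityMeasure (𝒟 t)]
    (z : Z)
    (νB : Measure Bool) [IsProbabilityMeasure νB]
    (ντ : Measure (Fin T)) [IsProbabilityMeasure ντ]
    (S : SeMI.Outputs O T → Fin T → ℝ) (hS : ∀ τ, Measurable fun o => S o τ)
    (R : ℕ) (ε δ ξ : ℝ) (hε : 0 ≤ ε) (hδ₀ : 0 ≤ δ) (hδ₁ : δ < 1) (hξ : 0 < ξ)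
    (hDP : SeMI.IsDP (SeMI.globalMechanism M T) ε δ) :
    1 - ξ ≤ (SeMI.gameLaw (SeMI.globalMechanism M T) 𝒟 z νB ντ R).real
      {w | SeMI.epsilonLB ξ δ (fun r => (w r).1.1) (fun r => S (w r).2 (w r).1.2) ≤ (ε : EReal)} := by
  rcases le_or_gt 1 ξ with hξ1 | hξ1
  · exact (sub_nonpos.2 hξ1).trans measureReal_nonneg
  set P := SeMI.gameLaw (SeMI.globalMechanism M T) 𝒟 z νB ντ R with hP
  have hround : IsProbabilityMeasure (SeMI.roundLaw (SeMI.globalMechanism M T) 𝒟 z νB ντ) := by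
    unfold SeMI.roundLaw; infer_instance
  have hPp : IsProbabilityMeasure P := by
    rw [hP]; unfold SeMI.gameLaw; infer_instance
  set σ := SeMI.statLaw (SeMI.globalMechanism M T) 𝒟 z ντ S with hσ
  have hσp : ∀ b, IsProbabilityMeasure (σ b) := SeMI.isProbabilityMeasure_statLaw hS
  set G := {w : Fin R → (Bool × Fin T) × SeMI.Outputs O T |
    SeMI.epsilonLB ξ δ (fun r => (w r).1.1) (fun r => S (w r).2 (w r).1.2) ≤ (ε : EReal)}
  set E₀ : (Fin R → Bool) → Set (Fin R → ℝ) := fun B =>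
    {X | ∃ γ, SeMI.ucbTypeI ξ B X γ < ((σ false).real (Set.Ioi γ) : EReal)}
  set E₁ : (Fin R → Bool) → Set (Fin R → ℝ) := fun B =>
    {X | ∃ γ, SeMI.ucbTypeII ξ B X γ < ((σ true).real (Set.Iic γ) : EReal)}
  have h₀ : P {w | (fun r => S (w r).2 (w r).1.2) ∈ E₀ fun r => (w r).1.1}
      ≤ ENNReal.ofReal (ξ / 4) :=
    SeMI.gameLaw_le_of_forall_pi_statLaw_le hS fun B => SeMI.pi_ucbTypeI_lt_le hξ hξ1 σ B
  have h₁ : P {w | (fun r => S (w r).2 (w r).1.2) ∈ E₁ fun r => (w r).1.1}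
      ≤ ENNReal.ofReal (ξ / 4) :=
    SeMI.gameLaw_le_of_forall_pi_statLaw_le hS fun B => SeMI.pi_ucbTypeII_lt_le hξ hξ1 σ B
  have hIoi : ∀ b γ, (σ b).real (Set.Ioi γ) = 1 - (σ b).real (Set.Iic γ) := fun b γ => by
    rw [← Set.compl_Iic, probReal_compl_eq_one_sub measurableSet_Iic]
  have hsub : Gᶜ ⊆ {w | (fun r => S (w r).2 (w r).1.2) ∈ E₀ fun r => (w r).1.1}
      ∪ {w | (fun r => S (w r).2 (w r).1.2) ∈ E₁ fun r => (w r).1.1} := by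
    intro w hw
    by_contra hcon
    rw [Set.mem_union, not_or] at hcon
    refine hw (SeMI.epsilonLB_le hξ hξ1 (α := fun γ => (σ false).real (Set.Ioi γ))
      (β := fun γ => (σ true).real (Set.Iic γ)) (fun γ => ?_) (fun γ => ?_)
      (fun γ => not_lt.1 fun h => hcon.1 ⟨γ, h⟩) (fun γ => not_lt.1 fun h => hcon.2 ⟨γ, h⟩))
    · have := SeMI.statLaw_real_le (𝒟 := 𝒟) (z := z) (ντ := ντ) hS hδ₀ hDP false
        (measurableSet_Iic (a := γ))
      rw [Bool.not_false, ← hσ] at this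
      rw [hIoi]; linarith
    · have := SeMI.statLaw_real_le (𝒟 := 𝒟) (z := z) (ντ := ντ) hS hδ₀ hDP true
        (measurableSet_Ioi (a := γ))
      rw [Bool.not_true, ← hσ, hIoi true] at this
      linarith
  have hbad : P.real Gᶜ ≤ ξ / 2 := by
    have : P Gᶜ ≤ ENNReal.ofReal (ξ / 2) := by
      refine ((measure_mono hsub).trans (measure_union_le _ _)).trans ((add_le_add h₀ h₁).trans ?_)
      rw [← ENNReal.ofReal_add (by positivity) (by positivity)]
      exact ENNReal.ofReal_le_ofReal (by linarith)
    exact ENNReal.toReal_le_of_le_ofReal (by positivity) this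
  have huniv : 1 ≤ P.real G + P.real Gᶜ := by
    have := measureReal_union_le (μ := P) G Gᶜ
    rwa [Set.union_compl_self, probReal_univ] at this
  linarith
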